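/- For an irrational $\gamma\in(0,1)$, let $c_\gamma$ be the characteristic Sturmian word of slope $\gamma$, i.e. the infinite word $c_\gamma=x_0x_1x_2\cdots$ over $\{a,b\}$ with $x_m=a$ if $\lfloor (m+2)\gamma\rfloor-\lfloor (m+1)\gamma\rfloor=0$ and $x_m=b$ otherwise. The sequence given by $c_\gamma$ over an alphabet $\{u,v\}$ is $(P_i)_{i\ge 1}$, where $P_i=u$ if $x_{i-1}=a$ and $P_i=v$ if $x_{i-1}=b$. Let $\alpha\in(0,\tfrac12)$ be irrational with continued fraction expansion $\alpha=[0;a_1,a_2,a_3,\ldots]$, and write $a_1=1+d_1$ and $a_i=d_i$ for $i\ge 2$, so that all $d_i\ge 1$. Put $q_0=1$, $q_1=a_1$, $q_n=a_nq_{n-1}+q_{n-2}$ for $n\ge 2$, and $s_{-1}=b$, $s_0=a$, $s_n=s_{n-1}^{d_n}s_{n-2}$ for $n\ge1$ (so $|s_n|=q_n$ for $n\ge 0$). Put $\alpha_n=[0;a_{n+1},a_{n+2},a_{n+3},\ldots]$ and $\alpha_{n,1}=[0;a_{n+1}+1,a_{n+2},a_{n+3},\ldots]$. For a finite word $w=x_1\cdots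 x_m$ and $0\le k\le m-1$, let $C_k(w)=x_{k+1}\cdots x_mx_1\cdots x_k$. Let $n\ge 1$ and $w=C_k(s_n)$ with $0\le k\le q_n-1$. Then $w$ occurs infinitely often in $c_\alpha$. Let $\mathrm{occ}_i(w)$ be the position of its $i$-th occurrence in $c_\alpha$ ($i\ge1$; positions are counted from $0$, and occurrences may overlap). Then $\mathrm{occ}_1(w)=k$ and $\mathrm{occ}_{i+1}(w)=\mathrm{occ}_i(w)+P_i$ for all $i\ge 1$, where $(P_i)_{i\ge1}$ is given by - $c_{\alpha_{n,1}}$ over the alphabet $\{q_n,\;q_{n-1}\}$ if $0\le k\le q_{n-1}-2$; - $c_{\alpha_n}$ over the alphabet $\{q_n,\;q_n+q_{n-1}\}$ if $q_{n-1}-1\le k\le q_n-1$. -/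

import Mathlib

namespace Sturmian

open Filter Topology

/-- The two-letter alphabet `{a, b}`. -/
inductive Letter : Type
  | a : Letter
  | b : Letter

/-! ### Continued fractions -/

/-- The regular continued fraction `[0; b 0, b 1, b 2, …]`. -/
noncomputable def infCF (b : ℕ → ℕ) : GenContFract ℝ :=
  ⟨0, Stream'.Seq.ofStream fun i => ⟨1, (b i : ℝ)⟩⟩

/-- The value of `[0; b 0, b 1, b 2, …]`, i.e. the limit of its convergents (the limit
exists whenever all `b i` are positive). -/
noncomputable def cfValue (b : ℕ → ℕ) : ℝ :=
  limUnder atTop fun m => (infCF b).convs m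

/-- The `i`-th partial quotient `aᵢ` (`i ≥ 1`) of `γ = [⌊γ⌋; a₁, a₂, …]`. Mathlib's sequence of
partial denominators is indexed from `0`; for irrational `γ` it never terminates and its entries
are positive integers (as real numbers). -/
noncomputable def partQuot (γ : ℝ) (i : ℕ) : ℕ :=
  ⌊((GenContFract.of γ).partDens.get? (i - 1)).getD 0⌋₊

/-- For `γ = [0; a₁, a₂, …]`, the number `γ_{n,k} = [0; a_{n+1} + k, a_{n+2}, a_{n+3}, …]`
(only `k ≥ 0` is needed). -/
noncomputable def shiftSlope (γ : ℝ) (n k : ℕ) : ℝ :=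
  cfValue fun j => if j = 0 then partQuot γ (n + 1) + k else partQuot γ (n + 1 + j)

/-- The denominators `q₀ = 1`, `q₁ = a₁`, `qₙ = aₙ qₙ₋₁ + qₙ₋₂` of the convergents to `γ`. -/
noncomputable def q (γ : ℝ) : ℕ → ℕ
  | 0 => 1
  | 1 => partQuot γ 1
  | m + 2 => partQuot γ (m + 2) * q γ (m + 1) + q γ m

/-! ### Characteristic and standard words -/

/-- The word `s_{γ,0}`: its `m`-th letter is `a` if `⌊(m+1)γ⌋ - ⌊mγ⌋ = 0`, and `b` otherwise. -/
noncomputable def lowerWord (γ : ℝ) (m : ℕ) : Letter :=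
  if ⌊((m : ℝ) + 1) * γ⌋ - ⌊(m : ℝ) * γ⌋ = 0 then Letter.a else Letter.b

/-- The characteristic word `c_γ`, given by `s_{γ,0} = a c_γ`. -/
noncomputable def charWord (γ : ℝ) (m : ℕ) : Letter :=
  lowerWord γ (m + 1)

/-- The directive sequence `(d₁, d₂, …)` of `γ = [0; 1 + d₁, d₂, d₃, …]`. -/
noncomputable def directive (γ : ℝ) (i : ℕ) : ℕ :=
  if i = 1 then partQuot γ 1 - 1 else partQuot γ i

/-- The standard sequence with its index raised by one: `stdAux γ m` is `s_{m-1}`, where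
`s₋₁ = b`, `s₀ = a`, `sₙ = sₙ₋₁^{dₙ} sₙ₋₂`. -/
noncomputable def stdAux (γ : ℝ) : ℕ → List Letter
  | 0 => [Letter.b]
  | 1 => [Letter.a]
  | m + 2 => (List.replicate (directive γ (m + 1)) (stdAux γ (m + 1))).flatten ++ stdAux γ m

/-- The standard word `sₙ`, `n ≥ 0`. -/
noncomputable def stdWord (γ : ℝ) (n : ℕ) : List Letter :=
  stdAux γ (n + 1)

/-- The `k`-th conjugate `C_k(w) = x_{k+1} ⋯ x_m x_1 ⋯ x_k` of `w = x_1 ⋯ x_m`. -/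
def conj (k : ℕ) (w : List Letter) : List Letter :=
  w.rotate k

/-! ### Occurrences -/

/-- The finite word `w` occurs at position `p` of the infinite word `x`. -/
def OccursAt (x : ℕ → Letter) (w : List Letter) (p : ℕ) : Prop :=
  ∀ (j : ℕ) (hj : j < w.length), x (p + j) = w[j]

/-- The position of the `i`-th occurrence (`i ≥ 1`) of `w` in `x`, provided that there are at
least `i` occurrences. -/
noncomputable def occ (x : ℕ → Letter) (w : List Letter) (i : ℕ) : ℕ :=
  Nat.nth (OccursAt x w) (i - 1)

/-- The letter `a` stands for the first member of the alphabet `{u, v}`, `b` for the second. -/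
def Letter.eval (u v : ℕ) : Letter → ℕ
  | Letter.a => u
  | Letter.b => v

/-- The sequence `P₁, P₂, …` given by the infinite word `x = x₀x₁x₂⋯` over the alphabet
`{u, v}`; its `i`-th term (`i ≥ 1`) comes from the letter `x_{i-1}`. -/
def overAlphabet (x : ℕ → Letter) (u v : ℕ) (i : ℕ) : ℕ :=
  (x (i - 1)).eval u v

end Sturmian

namespace Sturmian

/-! ### Partial quotients and the Gauss map -/

/-! The word is read off a rotation. Since `C_k(s_n)` is the factor of `c_α` at position `k`, it
occurs at `p` iff `⌊mα⌋` changes by a constant when the window `k+1 ≤ m ≤ k+1+q_n` is translated by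
`p-k`. Equivalently, the rotation by `(p-k)α` carries no `mα` of the window across an integer
(`ConvergentPair.agree_iff`). Up to a sign `σ`, this says that `(p-k)α` mod 1 lies in `(-d, D)`,
where `d` and `-D` are the signed distances to the integers nearest to 0 in the window.

Put `d = |q_n α - p_n|` and `d' = |q_{n-1} α - p_{n-1}|`. The value `d` always comes from `m = q_n`.
The other end is `D = d'`, from `m = q_{n-1}`, until the window reaches `m = q_n + q_{n-1}`, which
gives `D = d' - d`. This is the dichotomy in `k`.

The first return to an interval of length `D + d` is the exchange of two intervals: move by `d`
after `q_n` steps, or by `-D` after `q_{n-1}`, respectively `q_n + q_{n-1}`, steps. After rescaling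
it is the rotation by `d / (D + d)`, started so that its coding is a characteristic word
(`nth_visit`). As `d / d' = α_n`, this slope is `α_{n,1}` or `α_n`.

All bounds on return times come from writing `(r, N)` in the basis of two consecutive convergents
(`exists_coords`). -/

lemma irrational_fract {v : ℝ} (hv : Irrational v) : Irrational (Int.fract v) := by
  unfold Int.fract
  exact hv.sub_intCast _

lemma partQuot_one {v : ℝ} (hv : Irrational v) : partQuot v 1 = ⌊(Int.fract v)⁻¹⌋₊ := by
  have h : Int.fract v ≠ 0 := (irrational_fract hv).ne_zero
  have hs := GenContFract.of_s_head h
  simp only [Stream'.Seq.head] at hs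
  simp only [partQuot, GenContFract.partDens, Stream'.Seq.map_get?, Nat.sub_self, hs,
    Option.map_some, Option.getD_some]
  rw [← natCast_floor_eq_intCast_floor (inv_nonneg.2 (Int.fract_nonneg v)), Nat.floor_natCast]

lemma partQuot_succ_succ (v : ℝ) (i : ℕ) :
    partQuot v (i + 2) = partQuot (Int.fract v)⁻¹ (i + 1) := by
  simp [partQuot, GenContFract.partDens, Stream'.Seq.map_get?, GenContFract.of_s_succ]

lemma of_s_get? {v : ℝ} (hv : Irrational v) (i : ℕ) :
    (GenContFract.of v).s.get? i = some ⟨1, (partQuot v (i + 1) : ℝ)⟩ := by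
  induction i generalizing v with
  | zero =>
    have h : Int.fract v ≠ 0 := (irrational_fract hv).ne_zero
    have hs := GenContFract.of_s_head h
    simp only [Stream'.Seq.head] at hs
    rw [hs, partQuot_one hv]
    rw [natCast_floor_eq_intCast_floor (inv_nonneg.2 (Int.fract_nonneg v))]
  | succ i ih =>
    rw [GenContFract.of_s_succ, ih (irrational_fract hv).inv, partQuot_succ_succ]

lemma infCF_partQuot {v : ℝ} (hv : Irrational v) (h0 : 0 < v) (h1 : v < 1) :
    infCF (fun i => partQuot v (i + 1)) = GenContFract.of v := by
  have hh : (GenContFract.of v).h = 0 := by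
    rw [GenContFract.of_h_eq_floor, Int.floor_eq_zero_iff.2 ⟨h0.le, h1⟩, Int.cast_zero]
  have hs : (GenContFract.of v).s =
      Stream'.Seq.ofStream fun i => ⟨1, (partQuot v (i + 1) : ℝ)⟩ := by
    ext1 i
    rw [of_s_get? hv]
    rfl
  rw [infCF, ← hs, ← hh]

lemma cfValue_eq {v : ℝ} (hv : Irrational v) (h0 : 0 < v) (h1 : v < 1) {b : ℕ → ℕ}
    (hb : ∀ i, b i = partQuot v (i + 1)) : cfValue b = v := by
  obtain rfl : b = fun i => partQuot v (i + 1) := funext hb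
  rw [cfValue, infCF_partQuot hv h0 h1]
  exact (GenContFract.of_convergence v).limUnder_eq

lemma partQuot_fract {v : ℝ} (hv : Irrational v) (i : ℕ) :
    partQuot (Int.fract v) (i + 1) = partQuot v (i + 1) := by
  cases i with
  | zero => rw [partQuot_one hv, partQuot_one (irrational_fract hv), Int.fract_fract]
  | succ i => rw [partQuot_succ_succ, partQuot_succ_succ, Int.fract_fract]

/-- The orbit of `γ` under the Gauss map. -/
noncomputable def gaussIter (γ : ℝ) : ℕ → ℝ
  | 0 => γ
  | n + 1 => Int.fract (gaussIter γ n)⁻¹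

lemma gaussIter_spec {γ : ℝ} (hγ : Irrational γ) (h0 : 0 < γ) (h1 : γ < 1) (n : ℕ) :
    Irrational (gaussIter γ n) ∧ 0 < gaussIter γ n ∧ gaussIter γ n < 1 := by
  induction n with
  | zero => exact ⟨hγ, h0, h1⟩
  | succ n ih =>
    have h := irrational_fract ih.1.inv
    exact ⟨h, (Int.fract_nonneg _).lt_of_ne' h.ne_zero, Int.fract_lt_one _⟩

lemma partQuot_succ_of_mem {v : ℝ} (hv : Irrational v) (h0 : 0 < v) (h1 : v < 1) (i : ℕ) :
    partQuot v (i + 2) = partQuot (Int.fract v⁻¹) (i + 1) := by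
  rw [partQuot_succ_succ, Int.fract_eq_self.2 ⟨h0.le, h1⟩, partQuot_fract hv.inv]

lemma partQuot_gaussIter {γ : ℝ} (hγ : Irrational γ) (h0 : 0 < γ) (h1 : γ < 1) (n i : ℕ) :
    partQuot (gaussIter γ n) (i + 1) = partQuot γ (n + i + 1) := by
  induction n generalizing i with
  | zero => simp [gaussIter]
  | succ n ih =>
    obtain ⟨hi, hp, hl⟩ := gaussIter_spec hγ h0 h1 n
    rw [gaussIter, ← partQuot_succ_of_mem hi hp hl, ih (i + 1)]
    congr 1
    ring

lemma inv_gaussIter {γ : ℝ} (hγ : Irrational γ) (h0 : 0 < γ) (h1 : γ < 1) (n : ℕ) :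
    (gaussIter γ n)⁻¹ = partQuot γ (n + 1) + gaussIter γ (n + 1) := by
  obtain ⟨hi, hp, hl⟩ := gaussIter_spec hγ h0 h1 n
  have h := partQuot_gaussIter hγ h0 h1 n 0
  rw [zero_add, add_zero, partQuot_one hi, Int.fract_eq_self.2 ⟨hp.le, hl⟩] at h
  rw [← h, gaussIter, natCast_floor_eq_intCast_floor (inv_nonneg.2 hp.le), Int.floor_add_fract]

lemma one_le_partQuot {γ : ℝ} (hγ : Irrational γ) (h0 : 0 < γ) (h1 : γ < 1) (n : ℕ) :
    1 ≤ partQuot γ (n + 1) := by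
  obtain ⟨hi, hp, hl⟩ := gaussIter_spec hγ h0 h1 n
  have h := partQuot_gaussIter hγ h0 h1 n 0
  rw [zero_add, add_zero, partQuot_one hi, Int.fract_eq_self.2 ⟨hp.le, hl⟩] at h
  rw [← h]
  exact Nat.le_floor (by simpa using (one_le_inv₀ hp).2 hl.le)

lemma shiftSlope_zero {γ : ℝ} (hγ : Irrational γ) (h0 : 0 < γ) (h1 : γ < 1) (n : ℕ) :
    shiftSlope γ n 0 = gaussIter γ n := by
  obtain ⟨hi, hp, hl⟩ := gaussIter_spec hγ h0 h1 n
  refine cfValue_eq hi hp hl fun j => ?_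
  rw [partQuot_gaussIter hγ h0 h1]
  split_ifs with hj
  · simp [hj]
  · congr 1; omega

/-- Adding 1 to the inverse raises the first partial quotient by 1 and leaves its fractional part,
hence all later partial quotients, unchanged. -/
lemma shiftSlope_one {γ : ℝ} (hγ : Irrational γ) (h0 : 0 < γ) (h1 : γ < 1) (n : ℕ) :
    shiftSlope γ n 1 = (1 + (gaussIter γ n)⁻¹)⁻¹ := by
  obtain ⟨hi, hp, hl⟩ := gaussIter_spec hγ h0 h1 n
  have hinv : 0 < (gaussIter γ n)⁻¹ := inv_pos.2 hp
  set v := (1 + (gaussIter γ n)⁻¹)⁻¹ with hv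
  have hvi : Irrational v := by
    have := (hi.inv.natCast_add 1).inv
    simpa [hv] using this
  have hv0 : 0 < v := by positivity
  have hv1 : v < 1 := inv_lt_one_of_one_lt₀ (by linarith)
  refine cfValue_eq hvi hv0 hv1 fun j => ?_
  have hfl : v⁻¹ = (gaussIter γ n)⁻¹ + 1 := by rw [hv, inv_inv, add_comm]
  rcases j with _ | j
  · rw [if_pos rfl, zero_add, partQuot_one hvi, Int.fract_eq_self.2 ⟨hv0.le, hv1⟩, hfl,
      Nat.floor_add_one hinv.le]
    have h := partQuot_gaussIter hγ h0 h1 n 0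
    rw [zero_add, add_zero, partQuot_one hi, Int.fract_eq_self.2 ⟨hp.le, hl⟩] at h
    rw [h]
  · rw [if_neg (Nat.succ_ne_zero j), partQuot_succ_of_mem hvi hv0 hv1, hfl, Int.fract_add_one]
    have h := partQuot_gaussIter hγ h0 h1 (n + 1) j
    rw [gaussIter] at h
    rw [h]
    congr 1

/-! ### Convergents -/

/-- The numerators of the convergents to `γ ∈ (0, 1)`. -/
noncomputable def num (γ : ℝ) : ℕ → ℕ
  | 0 => 0
  | 1 => 1
  | m + 2 => partQuot γ (m + 2) * num γ (m + 1) + num γ m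

/-- The distance `|qₙ γ - pₙ|`. -/
noncomputable def err (γ : ℝ) : ℕ → ℝ
  | 0 => γ
  | n + 1 => err γ n * gaussIter γ (n + 1)

lemma err_pos {γ : ℝ} (hγ : Irrational γ) (h0 : 0 < γ) (h1 : γ < 1) (n : ℕ) : 0 < err γ n := by
  induction n with
  | zero => exact h0
  | succ n ih => exact mul_pos ih (gaussIter_spec hγ h0 h1 _).2.1

lemma err_succ_lt {γ : ℝ} (hγ : Irrational γ) (h0 : 0 < γ) (h1 : γ < 1) (n : ℕ) :
    err γ (n + 1) < err γ n :=
  mul_lt_of_lt_one_right (err_pos hγ h0 h1 n) (gaussIter_spec hγ h0 h1 _).2.2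

lemma err_lt_one {γ : ℝ} (hγ : Irrational γ) (h0 : 0 < γ) (h1 : γ < 1) (n : ℕ) :
    err γ n < 1 := by
  induction n with
  | zero => exact h1
  | succ n ih => exact (err_succ_lt hγ h0 h1 n).trans ih

/-- The Gauss map relation `x (a + x') = 1` gives the product of iterates the recursion of `q` and
`num`, up to alternating sign. This is what identifies `err` with the approximation error. -/
lemma err_add_two {γ : ℝ} (hγ : Irrational γ) (h0 : 0 < γ) (h1 : γ < 1) (n : ℕ) :
    err γ (n + 2) = err γ n - partQuot γ (n + 2) * err γ (n + 1) := by
  have h := inv_gaussIter hγ h0 h1 (n + 1)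
  have hp := (gaussIter_spec hγ h0 h1 (n + 1)).2.1
  have h2 : gaussIter γ (n + 1) * (partQuot γ (n + 2) + gaussIter γ (n + 2)) = 1 := by
    rw [← h, mul_inv_cancel₀ hp.ne']
  simp only [err]
  linear_combination err γ n * h2

lemma q_mul_sub_num {γ : ℝ} (hγ : Irrational γ) (h0 : 0 < γ) (h1 : γ < 1) (n : ℕ) :
    (-1) ^ n * (q γ n * γ - num γ n) = err γ n := by
  induction n using Nat.twoStepInduction with
  | zero => simp [q, num, err]
  | one =>
    have h := inv_gaussIter hγ h0 h1 0
    have h2 : γ * (partQuot γ 1 + gaussIter γ 1) = 1 := by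
      rw [← h, gaussIter, mul_inv_cancel₀ h0.ne']
    simp only [q, num, err]
    push_cast
    linear_combination -h2
  | more n ih ih' =>
    rw [err_add_two hγ h0 h1, ← ih, ← ih']
    simp only [q, num]
    push_cast
    ring

lemma det_convergents (γ : ℝ) (n : ℕ) :
    (q γ (n + 1) * num γ n - q γ n * num γ (n + 1) : ℤ) = (-1) ^ (n + 1) := by
  induction n with
  | zero => simp [q, num]
  | succ n ih =>
    rw [pow_succ, ← ih]
    simp only [q, num]
    push_cast
    ring

lemma one_le_q {γ : ℝ} (hγ : Irrational γ) (h0 : 0 < γ) (h1 : γ < 1) (n : ℕ) : 1 ≤ q γ n := by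
  induction n using Nat.twoStepInduction with
  | zero => exact le_rfl
  | one => exact one_le_partQuot hγ h0 h1 0
  | more n ih ih' => rw [q]; omega

lemma q_add_le {γ : ℝ} (hγ : Irrational γ) (h0 : 0 < γ) (h1 : γ < 1) (n : ℕ) :
    q γ (n + 1) + q γ n ≤ q γ (n + 2) := by
  rw [q]
  have := Nat.mul_le_mul_right (q γ (n + 1)) (one_le_partQuot hγ h0 h1 (n + 1))
  rw [one_mul, Nat.add_assoc] at this
  exact Nat.add_le_add_right this _

lemma two_le_partQuot_one {γ : ℝ} (hγ : Irrational γ) (h0 : 0 < γ) (h1 : γ < 1 / 2) :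
    2 ≤ partQuot γ 1 := by
  rw [partQuot_one hγ, Int.fract_eq_self.2 ⟨h0.le, by linarith⟩]
  refine Nat.le_floor ?_
  rw [le_inv_comm₀ (by norm_num) h0]
  norm_num
  linarith

lemma q_mono {γ : ℝ} (hγ : Irrational γ) (h0 : 0 < γ) (h1 : γ < 1) (n : ℕ) :
    q γ n ≤ q γ (n + 1) := by
  cases n with
  | zero => exact one_le_partQuot hγ h0 h1 0
  | succ n => exact (Nat.le_add_right _ _).trans (q_add_le hγ h0 h1 n)

lemma two_le_q {γ : ℝ} (hγ : Irrational γ) (h0 : 0 < γ) (h1 : γ < 1 / 2) (n : ℕ) :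
    2 ≤ q γ (n + 1) := by
  induction n with
  | zero => exact two_le_partQuot_one hγ h0 h1
  | succ n ih => exact ih.trans (q_mono hγ h0 (by linarith) _)


/-- Two consecutive convergents `P' / Q'`, `P / Q` of `α`, on opposite sides of `α`
as recorded by the sign `σ`, with errors `d'`, `d`. -/
structure ConvergentPair (α : ℝ) (Q Q' P P' σ : ℤ) (d d' : ℝ) : Prop where
  sign : σ = 1 ∨ σ = -1
  det : Q * P' - Q' * P = σ
  err_eq : σ * (Q * α - P) = d
  err_eq' : σ * (Q' * α - P') = -d'
  pos : 0 < d
  lt : d < d'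
  lt_one : d' < 1
  one_le : 1 ≤ Q'
  le : Q' ≤ Q

lemma convergentPair {γ : ℝ} (hγ : Irrational γ) (h0 : 0 < γ) (h1 : γ < 1) (n : ℕ) :
    ConvergentPair γ (q γ (n + 1)) (q γ n) (num γ (n + 1)) (num γ n) ((-1) ^ (n + 1))
      (err γ (n + 1)) (err γ n) where
  sign := neg_one_pow_eq_or ℤ (n + 1)
  det := det_convergents γ n
  err_eq := by
    have := q_mul_sub_num hγ h0 h1 (n + 1)
    push_cast at this ⊢
    exact this
  err_eq' := by
    have := q_mul_sub_num hγ h0 h1 n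
    push_cast at this ⊢
    rw [← this, pow_succ]
    ring
  pos := err_pos hγ h0 h1 _
  lt := err_succ_lt hγ h0 h1 n
  lt_one := err_lt_one hγ h0 h1 n
  one_le := by exact_mod_cast one_le_q hγ h0 h1 n
  le := by exact_mod_cast q_mono hγ h0 h1 n

namespace ConvergentPair

variable {α : ℝ} {Q Q' P P' σ : ℤ} {d d' : ℝ}

/-- The determinant is `±1`, so `(Q, P)` and `(Q', P')` form a basis of `ℤ²`; the coordinates come
from Cramer's rule. A window for the signed distance then constrains `u` and `v`, and with `r > 0`
bounds `r` below. -/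
lemma exists_coords (h : ConvergentPair α Q Q' P P' σ d d') (r N : ℤ) :
    ∃ u v : ℤ, r = u * Q + v * Q' ∧ (σ * (r * α - N) : ℝ) = u * d - v * d' := by
  have hσ : σ * σ = 1 := by rcases h.sign with h | h <;> simp [h]
  have hr : r = σ * (r * P' - N * Q') * Q + σ * (Q * N - P * r) * Q' := by
    linear_combination (-r) * hσ - σ * r * h.det
  have hN : N = σ * (r * P' - N * Q') * P + σ * (Q * N - P * r) * P' := by
    linear_combination (-N) * hσ - σ * N * h.det
  refine ⟨σ * (r * P' - N * Q'), σ * (Q * N - P * r), hr, ?_⟩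
  generalize σ * (r * P' - N * Q') = u at *
  generalize σ * (Q * N - P * r) = v at *
  rw [hr, hN]
  push_cast
  linear_combination u * h.err_eq + v * h.err_eq'

lemma pos_of_mul_pos {x d : ℝ} {u : ℤ} (hd : 0 < d) (hx : 0 ≤ x) (h : x < u * d) : 1 ≤ u := by
  have : (0 : ℝ) < u := pos_of_mul_pos_left (hx.trans_lt h) hd.le
  exact_mod_cast this

lemma nonpos_of_mul_neg {x d : ℝ} {u : ℤ} (hd : 0 < d) (hx : x ≤ d) (h : u * d < x) :
    u ≤ 0 := by
  by_contra! hu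
  have : (1 : ℝ) ≤ u := by exact_mod_cast hu
  nlinarith

/-- A positive multiple of `α` strictly closer to an integer than `Q'` on one side and than `Q` on
the other is at least the `(Q + Q')`-th. -/
lemma add_le_of_mem (h : ConvergentPair α Q Q' P P' σ d d') {r N : ℤ} (hr : 0 < r)
    (h1 : -d' < σ * (r * α - N)) (h2 : σ * (r * α - N) < d) : Q + Q' ≤ r := by
  obtain ⟨u, v, rfl, e⟩ := h.exists_coords r N
  rw [e] at h1 h2
  have hd := h.pos
  have hd' := hd.trans h.lt
  have hQ' := h.one_le
  have hQ := h.le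
  rcases le_or_gt v 0 with hv | hv
  · have hv' : (v : ℝ) ≤ 0 := by exact_mod_cast hv
    have hu : u ≤ 0 := nonpos_of_mul_neg (x := d + v * d') hd (by nlinarith) (by linarith)
    nlinarith
  · have hv' : (1 : ℝ) ≤ v := by exact_mod_cast hv
    have hu : 1 ≤ u := pos_of_mul_pos (x := (v - 1) * d') hd (by nlinarith) (by linarith)
    nlinarith

/-- Compared with the wider window, `v ≥ 1` now forces `u ≥ 2`, since `u d > (v - 1) d' + d`. -/
lemma two_mul_add_le_of_mem (h : ConvergentPair α Q Q' P P' σ d d') {r N : ℤ} (hr : 0 < r)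
    (h1 : -(d' - d) < σ * (r * α - N)) (h2 : σ * (r * α - N) < d) : 2 * Q + Q' ≤ r := by
  obtain ⟨u, v, rfl, e⟩ := h.exists_coords r N
  rw [e] at h1 h2
  have hd := h.pos
  have hd' := hd.trans h.lt
  have hQ' := h.one_le
  have hQ := h.le
  rcases le_or_gt v 0 with hv | hv
  · have hv' : (v : ℝ) ≤ 0 := by exact_mod_cast hv
    have hu : u ≤ 0 := nonpos_of_mul_neg (x := d + v * d') hd (by nlinarith) (by linarith)
    nlinarith
  · have hv' : (1 : ℝ) ≤ v := by exact_mod_cast hv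
    have hu : 1 ≤ u - 1 := pos_of_mul_pos (x := (v - 1) * d') hd (by nlinarith)
      (by push_cast; linarith)
    nlinarith

lemma le_of_mem (h : ConvergentPair α Q Q' P P' σ d d') {r N : ℤ} (hr : 0 < r)
    (h1 : -d' < σ * (r * α - N)) (h2 : σ * (r * α - N) < d' + d) : Q ≤ r := by
  obtain ⟨u, v, rfl, e⟩ := h.exists_coords r N
  rw [e] at h1 h2
  have hd := h.pos
  have hd' := hd.trans h.lt
  have hQ' := h.one_le
  have hQ := h.le
  rcases lt_trichotomy v 0 with hv | rfl | hv
  · have hv' : (v : ℝ) ≤ -1 := by exact_mod_cast Int.le_sub_one_of_lt hv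
    have hu : u ≤ 0 := nonpos_of_mul_neg (x := d + (v + 1) * d') hd (by nlinarith) (by linarith)
    nlinarith
  · have hu : 0 < u := by
      by_contra! hu
      nlinarith
    nlinarith
  · have hv' : (1 : ℝ) ≤ v := by exact_mod_cast hv
    have hu : 1 ≤ u := pos_of_mul_pos (x := (v - 1) * d') hd (by nlinarith) (by linarith)
    nlinarith

lemma le_of_mem' (h : ConvergentPair α Q Q' P P' σ d d') {r N : ℤ} (hr : 0 < r)
    (h1 : -d' - d < σ * (r * α - N)) (h2 : σ * (r * α - N) < d) : Q' ≤ r := by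
  obtain ⟨u, v, rfl, e⟩ := h.exists_coords r N
  rw [e] at h1 h2
  have hd := h.pos
  have hd' := hd.trans h.lt
  have hQ' := h.one_le
  have hQ := h.le
  rcases le_or_gt v 0 with hv | hv
  · have hv' : (v : ℝ) ≤ 0 := by exact_mod_cast hv
    have hu : u ≤ 0 := nonpos_of_mul_neg (x := d + v * d') hd (by nlinarith) (by linarith)
    nlinarith
  · have hv' : (1 : ℝ) ≤ v := by exact_mod_cast hv
    have hu : 1 ≤ u + 1 := pos_of_mul_pos (x := (v - 1) * d') hd (by nlinarith)
      (by push_cast; linarith)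
    nlinarith

lemma le_of_mem_Icc (h : ConvergentPair α Q Q' P P' σ d d') {r N : ℤ} (hr : 0 < r)
    (h1 : 0 ≤ σ * (r * α - N)) (h2 : σ * (r * α - N) ≤ d') : Q ≤ r := by
  have hd := h.pos
  exact h.le_of_mem hr (by linarith [h.lt]) (by linarith)

/-- Below `Q`, translation by `Q'` changes the integer part of the multiples of `α` by `P'`. -/
lemma floor_add_mul (h : ConvergentPair α Q Q' P P' σ d d') {m : ℤ} (hm : 0 < m) (hmQ : m < Q) :
    ⌊((m + Q' : ℤ) : ℝ) * α⌋ = ⌊(m : ℝ) * α⌋ + P' := by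
  have hf0 := Int.floor_le ((m : ℝ) * α)
  have hf1 := Int.lt_floor_add_one ((m : ℝ) * α)
  -- Translation by `Q'` moves the point by `d'` against the direction `σ`. It would cross an
  -- integer only from within `d'` of it, which needs `m ≥ Q`.
  have hN : ∀ N : ℤ, ¬ (0 ≤ (σ * (m * α - N) : ℝ) ∧ (σ * (m * α - N) : ℝ) ≤ d') :=
    fun N hN => absurd (h.le_of_mem_Icc hm hN.1 hN.2) (not_le.2 hmQ)
  have ha := hN ⌊(m : ℝ) * α⌋
  have hb := hN (⌊(m : ℝ) * α⌋ + 1)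
  have he := h.err_eq'
  have hd' := h.pos.trans h.lt
  rw [Int.floor_eq_iff]
  push_cast at *
  rcases h.sign with hs | hs <;> subst hs <;> push_cast at *
  · have : d' < m * α - ⌊(m : ℝ) * α⌋ := by
      by_contra! hc
      exact ha ⟨by linarith, by linarith⟩
    constructor <;> linarith
  · have : m * α - (⌊(m : ℝ) * α⌋ + 1) < -d' := by
      by_contra! hc
      exact hb ⟨by linarith, by linarith⟩
    constructor <;> linarith

end ConvergentPair

/-! ### Letters and floors -/

lemma floor_sub_floor_mem {γ : ℝ} (h0 : 0 < γ) (h1 : γ < 1) (x : ℝ) :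
    ⌊x + γ⌋ - ⌊x⌋ = 0 ∨ ⌊x + γ⌋ - ⌊x⌋ = 1 := by
  have hl : ⌊x⌋ ≤ ⌊x + γ⌋ := Int.floor_mono (by linarith)
  have hu : ⌊x + γ⌋ ≤ ⌊x⌋ + 1 := by
    rw [← Int.floor_add_one]
    exact Int.floor_mono (by linarith)
  omega

lemma charWord_eq (γ : ℝ) (p : ℕ) : charWord γ p =
    if ⌊((p : ℝ) + 1) * γ + γ⌋ - ⌊((p : ℝ) + 1) * γ⌋ = 0 then Letter.a else Letter.b := by
  simp only [charWord, lowerWord]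
  push_cast
  rw [show ((p : ℝ) + 1) * γ + γ = (p + 1 + 1) * γ by ring]

lemma charWord_eq_iff {γ : ℝ} (h0 : 0 < γ) (h1 : γ < 1) (i j : ℕ) :
    charWord γ i = charWord γ j ↔ ⌊((i : ℝ) + 1) * γ + γ⌋ - ⌊((i : ℝ) + 1) * γ⌋ =
      ⌊((j : ℝ) + 1) * γ + γ⌋ - ⌊((j : ℝ) + 1) * γ⌋ := by
  rw [charWord_eq, charWord_eq]
  rcases floor_sub_floor_mem h0 h1 (((i : ℝ) + 1) * γ) with hi | hi <;>
  rcases floor_sub_floor_mem h0 h1 (((j : ℝ) + 1) * γ) with hj | hj <;> simp [hi, hj]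

/-- Two factors of a characteristic word agree iff the integer parts differ by a constant. -/
lemma charWord_agree_iff {γ : ℝ} (h0 : 0 < γ) (h1 : γ < 1) (p k l : ℕ) :
    (∀ j < l, charWord γ (p + j) = charWord γ (k + j)) ↔
      ∃ N : ℤ, ∀ j : ℕ, j ≤ l →
        ⌊((p : ℝ) + 1 + j) * γ⌋ = ⌊((k : ℝ) + 1 + j) * γ⌋ + N := by
  have key : ∀ j : ℕ, charWord γ (p + j) = charWord γ (k + j) ↔
      ⌊((p : ℝ) + 1 + (j + 1 : ℕ)) * γ⌋ - ⌊((p : ℝ) + 1 + j) * γ⌋ =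
      ⌊((k : ℝ) + 1 + (j + 1 : ℕ)) * γ⌋ - ⌊((k : ℝ) + 1 + j) * γ⌋ := by
    intro j
    rw [charWord_eq_iff h0 h1]
    push_cast
    ring_nf
  constructor
  · intro h
    refine ⟨⌊((p : ℝ) + 1) * γ⌋ - ⌊((k : ℝ) + 1) * γ⌋, fun j => ?_⟩
    induction j with
    | zero => intro _; simp
    | succ j ih =>
      intro hj
      have h1 := ih (by omega)
      have h2 := (key j).1 (h j (by omega))
      omega
  · rintro ⟨N, hN⟩ j hj
    have h1 := hN j hj.le
    have h2 := hN (j + 1) hj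
    rw [key]
    omega

/-! ### Standard words are prefixes of the characteristic word -/

/-- Letter `j` compares the multiples `j + 1` and `j + 2`, and both must stay below `q γ (n + 1)`.
-/
lemma charWord_add_q {γ : ℝ} (hγ : Irrational γ) (h0 : 0 < γ) (h1 : γ < 1) (n j : ℕ)
    (hj : j + 2 < q γ (n + 1)) : charWord γ (j + q γ n) = charWord γ j := by
  have h := convergentPair hγ h0 h1 n
  have e1 := h.floor_add_mul (m := (j + 1 : ℕ)) (by positivity) (by norm_cast; omega)
  have e2 := h.floor_add_mul (m := (j + 2 : ℕ)) (by positivity) (by norm_cast)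
  rw [charWord_eq_iff h0 h1]
  push_cast at e1 e2 ⊢
  rw [show ((j : ℝ) + q γ n + 1) * γ + γ = (j + 2 + q γ n) * γ by ring,
    show ((j : ℝ) + q γ n + 1) * γ = (j + 1 + q γ n) * γ by ring, e1, e2,
    show ((j : ℝ) + 1) * γ + γ = (j + 2) * γ by ring]
  ring

/-- The prefix of length `l`. -/
noncomputable def charPrefix (γ : ℝ) (l : ℕ) : List Letter :=
  List.ofFn fun j : Fin l => charWord γ j

lemma charPrefix_add (γ : ℝ) (l m : ℕ) (h : ∀ j < m, charWord γ (l + j) = charWord γ j) :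
    charPrefix γ (l + m) = charPrefix γ l ++ charPrefix γ m := by
  simp only [charPrefix, List.ofFn_add]
  congr 2
  funext j
  simpa using h j j.2

lemma charPrefix_mul_add (γ : ℝ) (l m d : ℕ)
    (h : ∀ j, j + l < d * l + m → charWord γ (l + j) = charWord γ j) :
    charPrefix γ (d * l + m) =
      (List.replicate d (charPrefix γ l)).flatten ++ charPrefix γ m := by
  induction d with
  | zero => simp
  | succ d ih =>
    rw [List.replicate_succ, List.flatten_cons, List.append_assoc, ← ih, ← charPrefix_add]
    · congr 1
      ring
    · intro j hj
      exact h j (by rw [Nat.succ_mul]; omega)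
    · intro j hj
      exact h j (by rw [Nat.succ_mul]; omega)

lemma stdWord_zero_eq {γ : ℝ} (h0 : 0 < γ) (h1 : γ < 1 / 2) : stdWord γ 0 = charPrefix γ 1 := by
  have : charWord γ 0 = Letter.a := by
    rw [charWord_eq, if_pos]
    have e1 : ⌊((0 : ℕ) + 1 : ℝ) * γ + γ⌋ = 0 := by
      rw [Int.floor_eq_zero_iff]
      constructor <;> push_cast <;> linarith
    have e2 : ⌊((0 : ℕ) + 1 : ℝ) * γ⌋ = 0 := by
      rw [Int.floor_eq_zero_iff]
      constructor <;> push_cast <;> linarith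
    rw [e1, e2, sub_zero]
  simp [stdWord, stdAux, charPrefix, this]

lemma stdWord_one_eq {γ : ℝ} (hγ : Irrational γ) (h0 : 0 < γ) (h1 : γ < 1 / 2) :
    stdWord γ 1 = charPrefix γ (q γ 1) := by
  obtain ⟨c, hc⟩ : ∃ c, partQuot γ 1 = c + 1 :=
    ⟨_, (Nat.sub_add_cancel (one_le_partQuot hγ h0 (by linarith) 0)).symm⟩
  have hfl : (partQuot γ 1 : ℝ) * γ < 1 ∧ 1 < (partQuot γ 1 + 1) * γ := by
    have h := inv_gaussIter hγ h0 (by linarith) 0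
    obtain ⟨-, hp, hl⟩ := gaussIter_spec hγ h0 (by linarith) 1
    have h2 : γ * (partQuot γ 1 + gaussIter γ 1) = 1 := by
      rw [← h, gaussIter, mul_inv_cancel₀ h0.ne']
    constructor <;> nlinarith
  rw [hc] at hfl
  push_cast at hfl
  have hz : ∀ j : ℕ, j ≤ c + 1 → ⌊(j : ℝ) * γ⌋ = 0 := by
    intro j hj
    have : (j : ℝ) ≤ c + 1 := by exact_mod_cast hj
    rw [Int.floor_eq_zero_iff]
    constructor
    · positivity
    · nlinarith [hfl.1]
  have ha : ∀ j < c, charWord γ j = Letter.a := by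
    intro j hj
    have e1 := hz (j + 1) (by omega)
    have e2 := hz (j + 2) (by omega)
    push_cast at e1 e2
    rw [charWord_eq, if_pos]
    rw [show ((j : ℝ) + 1) * γ + γ = (j + 2) * γ by ring, e1, e2, sub_zero]
  have hb : charWord γ c = Letter.b := by
    have e1 := hz (c + 1) le_rfl
    have e2 : ⌊((c : ℝ) + 1) * γ + γ⌋ = 1 := by
      rw [Int.floor_eq_iff]
      constructor <;> push_cast <;> nlinarith [hfl.1, hfl.2]
    push_cast at e1
    rw [charWord_eq, e1, e2]
    simp
  have e : charPrefix γ c = List.replicate c Letter.a := by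
    rw [charPrefix, ← List.ofFn_const]
    congr 1
    funext j
    exact ha j j.2
  rw [q, hc, charPrefix, List.ofFn_succ_last]
  simp only [Fin.val_last, Fin.val_castSucc, hb]
  rw [← charPrefix, e]
  simp [stdWord, stdAux, directive, hc]

lemma stdWord_eq {γ : ℝ} (hγ : Irrational γ) (h0 : 0 < γ) (h1 : γ < 1 / 2) (n : ℕ) :
    stdWord γ n = charPrefix γ (q γ n) := by
  induction n using Nat.twoStepInduction with
  | zero => exact stdWord_zero_eq h0 h1
  | one => exact stdWord_one_eq hγ h0 h1
  | more n ih ih' =>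
    rw [stdWord, stdAux, ← stdWord, ← stdWord, ih, ih', directive, if_neg (by omega), q,
      charPrefix_mul_add]
    intro j hj
    rw [add_comm]
    refine charWord_add_q hγ h0 (by linarith) _ _ ?_
    -- The two letters lost at the end of the range of periodicity are absorbed by `q γ (n + 1) ≥
    -- 2`; this is where slope below `1/2` matters.
    have := two_le_q hγ h0 h1 n
    rw [q]
    omega

/-- The prefix of `c_γ` with period `q γ (n + 1)` is long enough to contain the wrapped part of
every conjugate, so the conjugate is the factor at position `k`. -/
lemma occursAt_conj_iff {γ : ℝ} (hγ : Irrational γ) (h0 : 0 < γ) (h1 : γ < 1 / 2) (n k : ℕ)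
    (hk : k < q γ (n + 1)) (p : ℕ) :
    OccursAt (charWord γ) (conj k (stdWord γ (n + 1))) p ↔
      ∀ j < q γ (n + 1), charWord γ (p + j) = charWord γ (k + j) := by
  have hlen : (conj k (stdWord γ (n + 1))).length = q γ (n + 1) := by
    rw [conj, List.length_rotate, stdWord_eq hγ h0 h1, charPrefix, List.length_ofFn]
  have hget : ∀ j (hj : j < (conj k (stdWord γ (n + 1))).length),
      (conj k (stdWord γ (n + 1)))[j] = charWord γ (k + j) := by
    intro j hj
    have hj' : j < q γ (n + 1) := hlen ▸ hj
    simp only [conj, List.getElem_rotate, stdWord_eq hγ h0 h1, charPrefix, List.length_ofFn,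
      List.getElem_ofFn]
    rcases lt_or_ge (j + k) (q γ (n + 1)) with hlt | hge
    · rw [Nat.mod_eq_of_lt hlt, add_comm]
    · rw [Nat.mod_eq_sub_mod hge, Nat.mod_eq_of_lt (by omega)]
      have hq := q_add_le hγ h0 (by linarith) n
      have hq' := one_le_q hγ h0 (by linarith) n
      have := charWord_add_q hγ h0 (by linarith) (n + 1) (j + k - q γ (n + 1)) (by
        change _ < q γ (n + 2); omega)
      rw [← this]
      congr 1
      omega
  constructor
  · intro h j hj
    rw [h j (hlen ▸ hj), hget]
  · intro h j hj
    rw [hget, h j (hlen ▸ hj)]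


/-! ### Occurrences as visits of an orbit to an interval -/

lemma mul_ne_intCast {α : ℝ} (hα : Irrational α) {r : ℤ} (hr : 0 < r) (N : ℤ) : (r : ℝ) * α ≠ N :=
  (hα.intCast_mul hr.ne').ne_int N

/-- `hgap` says that no signed distance in the window lies in `(-D, d)`, so a rotation by an amount
in that interval crosses no integer. Conversely `-D` is attained by `hwit`, and `d` at `m = Q`, so a
larger rotation makes one of these points cross. -/
lemma ConvergentPair.agree_iff {α : ℝ} {Q Q' P P' σ : ℤ} {d d' : ℝ}
    (h : ConvergentPair α Q Q' P P' σ d d') (hα : Irrational α) {l : ℕ} (hl : (l : ℤ) = Q)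
    {p k : ℕ} (hk : k < l) {D : ℝ} (hD : 0 < D) (hD' : D ≤ d')
    (hgap : ∀ m M : ℤ, 0 < m → m ≤ k + 1 + Q → -D < σ * (m * α - M) → d ≤ σ * (m * α - M))
    (hwit : ∃ (j : ℕ) (M : ℤ), j ≤ l ∧ (σ * (((k + 1 + j : ℤ) : ℝ) * α - M) : ℝ) = -D) :
    (∃ N : ℤ, ∀ j : ℕ, j ≤ l → ⌊((p : ℝ) + 1 + j) * α⌋ = ⌊((k : ℝ) + 1 + j) * α⌋ + N) ↔
      ∃ N : ℤ, -d < σ * (((p : ℝ) - k) * α - N) ∧ σ * (((p : ℝ) - k) * α - N) < D := by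
  have hd := h.pos
  have hlt := h.lt
  have hone := h.lt_one
  constructor
  · rintro ⟨N, hN⟩
    refine ⟨N, ?_⟩
    obtain ⟨j₀, M₀, hj₀, hM₀⟩ := hwit
    -- Landing exactly on an integer would make `(p + 1 + j) α` an integer; this makes the interval
    -- open at both ends.
    have hne : ∀ j : ℕ, ∀ M : ℤ, ((p : ℝ) - k) * α - N ≠ -((k + 1 + j) * α - M) := by
      intro j M he
      refine mul_ne_intCast hα (r := p + 1 + j) (by positivity) (N + M) ?_
      push_cast
      linear_combination he
    obtain ⟨j₁, hj₁⟩ : ∃ j₁, l = k + 1 + j₁ := Nat.exists_eq_add_of_le hk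
    have hQ : (Q : ℝ) = k + 1 + j₁ := by
      rw [← hl, hj₁]
      push_cast
      ring
    have e₀ := hN j₀ hj₀
    have e₁ := hN j₁ (by omega)
    have ne₀ := hne j₀ M₀
    have ne₁ := hne j₁ P
    have hP := h.err_eq
    rw [hQ] at hP
    push_cast at hM₀
    have key : ∀ (j : ℕ) (M : ℤ), ⌊((p : ℝ) + 1 + j) * α⌋ = ⌊((k : ℝ) + 1 + j) * α⌋ + N →
        ⌊((k : ℝ) + 1 + j) * α⌋ = M →
        0 ≤ ((k : ℝ) + 1 + j) * α - M + (((p : ℝ) - k) * α - N) ∧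
        ((k : ℝ) + 1 + j) * α - M + (((p : ℝ) - k) * α - N) < 1 := by
      intro j M he hM
      rw [hM, Int.floor_eq_iff] at he
      push_cast at he
      constructor <;> linarith [he.1, he.2]
    rcases h.sign with hs | hs <;> subst hs <;> push_cast at *
    · have k₀ := key j₀ (M₀ - 1) e₀ (by
        rw [Int.floor_eq_iff]
        push_cast
        constructor <;> linarith)
      have k₁ := key j₁ P e₁ (by
        rw [Int.floor_eq_iff]
        constructor <;> linarith)
      push_cast at k₀
      constructor
      · refine lt_of_le_of_ne (by linarith) fun hc => ne₁ ?_
        linarith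
      · linarith
    · have k₀ := key j₀ M₀ e₀ (by
        rw [Int.floor_eq_iff]
        constructor <;> linarith)
      have k₁ := key j₁ (P - 1) e₁ (by
        rw [Int.floor_eq_iff]
        push_cast
        constructor <;> linarith)
      push_cast at k₁
      constructor
      · linarith
      · refine lt_of_le_of_ne (by linarith) fun hc => ne₀ ?_
        linarith
  · rintro ⟨N, hN₁, hN₂⟩
    refine ⟨N, fun j hj => ?_⟩
    have hg : ∀ M : ℤ, -D < σ * (((k : ℝ) + 1 + j) * α - M) →
        d ≤ σ * (((k : ℝ) + 1 + j) * α - M) := by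
      intro M hM
      have := hgap (k + 1 + j) M (by positivity) (by rw [← hl]; gcongr)
      push_cast at this
      exact this hM
    have hf0 := Int.floor_le (((k : ℝ) + 1 + j) * α)
    have hf1 := Int.lt_floor_add_one (((k : ℝ) + 1 + j) * α)
    have g₀ := hg ⌊((k : ℝ) + 1 + j) * α⌋
    have g₁ := hg (⌊((k : ℝ) + 1 + j) * α⌋ + 1)
    rw [Int.floor_eq_iff]
    rcases h.sign with hs | hs <;> subst hs <;> push_cast at *
    · have a₀ := g₀ (by linarith)
      have a₁ : 1 * (((k : ℝ) + 1 + j) * α - (⌊((k : ℝ) + 1 + j) * α⌋ + 1)) ≤ -D := by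
        by_contra! hc
        linarith [g₁ hc]
      constructor <;> linarith
    · have a₀ := g₁ (by linarith)
      have a₁ : -1 * (((k : ℝ) + 1 + j) * α - ⌊((k : ℝ) + 1 + j) * α⌋) ≤ -D := by
        by_contra! hc
        linarith [g₀ hc]
      constructor <;> linarith

/-! ### Coding of the return times -/

lemma count_add_eq_succ {R : ℕ → Prop} [DecidablePred R] {x u : ℕ} (hu : 0 < u) (hx : R x)
    (hbetween : ∀ z, x < z → z < x + u → ¬ R z) :
    Nat.count R (x + u) = Nat.count R x + 1 := by
  obtain ⟨u, rfl⟩ := Nat.exists_eq_add_of_lt hu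
  have h : Nat.count (fun j => R (x + (j + 1))) u = 0 :=
    Nat.count_iff_forall_not.2 fun m hm => hbetween _ (by omega) (by omega)
  rw [Nat.count_add, zero_add, Nat.count_succ', h]
  simp [hx]

open Classical in
/-- If `R` is the set of visits of a rotation orbit to the interval `(-d, D)`, on which the first
return map is the exchange of two intervals, then the return times are coded by the
characteristic word of slope `d / (D + d)`. -/
theorem nth_visit {α : ℝ} (hα : Irrational α) {σ U V : ℤ} {u v k : ℕ} {d D : ℝ} (hd : 0 < d)
    (hD : 0 < D) (hU : σ * (u * α - U) = d) (hV : σ * (v * α - V) = -D)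
    (hku : k < u) (hkv : k < v)
    (hmin_u : ∀ r N : ℤ, 0 < r → -D < σ * (r * α - N) → σ * (r * α - N) < D + d → u ≤ r)
    (hmin_v : ∀ r N : ℤ, 0 < r → -D - d < σ * (r * α - N) → σ * (r * α - N) < d → v ≤ r)
    {R : ℕ → Prop}
    (hR : ∀ p : ℕ, R p ↔ ∃ N : ℤ, -d < σ * (((p : ℝ) - k) * α - N) ∧
      σ * (((p : ℝ) - k) * α - N) < D) :
    Nat.nth R 0 = k ∧ (∀ i, R (Nat.nth R i)) ∧
      ∀ i, Nat.nth R (i + 1) = Nat.nth R i + (charWord (d / (D + d)) i).eval u v := by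
  set β := d / (D + d) with hβ
  have hDβ : (D + d) * β = d := by rw [hβ]; field_simp
  have hβ0 : 0 < β := by positivity
  have hβ1 : β < 1 := by rw [hβ, div_lt_one (by positivity)]; linarith
  have hσ0 : (σ : ℝ) ≠ 0 := by
    rintro h
    rw [h, zero_mul] at hU
    exact hd.ne hU
  -- Positions are measured from the left end `-d`. The first visit, at offset 0, thus sits at `d =
  -- (D + d) β`, which accounts for the index `i + 1` in the invariant and for the coding being
  -- characteristic.
  have base : R k ∧ Nat.count R k = 0 ∧
      ∃ N : ℤ, σ * (((k : ℝ) - k) * α - N) + d = (D + d) * Int.fract (((0 : ℕ) + 1 : ℝ) * β) := by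
    refine ⟨(hR k).2 ⟨0, by simpa using hd, by simpa using hD⟩, ?_, 0, ?_⟩
    · rw [Nat.count_iff_forall_not]
      intro p hp hRp
      obtain ⟨N, h1, h2⟩ := (hR p).1 hRp
      -- A visit before `k`, seen backwards, would be a return in less than `v` steps.
      have : (v : ℤ) ≤ (k : ℤ) - p := by
        refine hmin_v _ (-N) (by omega) ?_ ?_ <;> push_cast <;> linarith
      omega
    · rw [Nat.cast_zero, zero_add, one_mul, Int.fract_eq_self.2 ⟨hβ0.le, hβ1⟩, hDβ]
      simp
  have step : ∀ i x, (R x ∧ Nat.count R x = i ∧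
      ∃ N : ℤ, σ * (((x : ℝ) - k) * α - N) + d = (D + d) * Int.fract ((i + 1 : ℝ) * β)) →
      R (x + (charWord β i).eval u v) ∧ Nat.count R (x + (charWord β i).eval u v) = i + 1 ∧
      ∃ N : ℤ, σ * (((x + (charWord β i).eval u v : ℕ) - k : ℝ) * α - N) + d =
        (D + d) * Int.fract (((i + 1 : ℕ) + 1 : ℝ) * β) := by
    rintro i x ⟨hx, hc, N, hN⟩
    have hf0 := Int.fract_nonneg ((i + 1 : ℝ) * β)
    have hf1 := Int.fract_lt_one ((i + 1 : ℝ) * β)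
    have hfl := Int.floor_add_fract ((i + 1 : ℝ) * β)
    set y := Int.fract ((i + 1 : ℝ) * β) with hy
    set F := ⌊(i + 1 : ℝ) * β⌋ with hF
    have hbetween : ∀ z, x < z → R z → ∃ N' : ℤ,
        -((D + d) * y) < σ * (((z : ℤ) - x : ℤ) * α - N') ∧
        (σ * (((z : ℤ) - x : ℤ) * α - N') : ℝ) < D + d - (D + d) * y := by
      intro z hz hRz
      obtain ⟨N', h1, h2⟩ := (hR z).1 hRz
      refine ⟨N' - N, ?_, ?_⟩ <;> push_cast <;> linarith
    -- Either there is room to move right by `d`, or the rescaled rotation wraps and the net move is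
    -- `d - (D + d) = -D`.
    rcases lt_or_ge (y + β) 1 with hlt | hge
    · have hfloor : ⌊(i + 1 : ℝ) * β + β⌋ = F := by
        rw [Int.floor_eq_iff]
        constructor <;> linarith
      have hw : charWord β i = Letter.a := by rw [charWord_eq, hfloor, if_pos (sub_self _)]
      have hfr : Int.fract (((i + 1 : ℕ) + 1 : ℝ) * β) = y + β := by
        push_cast
        rw [show ((i : ℝ) + 1 + 1) * β = (i + 1) * β + β by ring, Int.fract, hfloor]
        linarith
      have hyD : (D + d) * y + d < D + d := by
        rw [← hDβ]
        nlinarith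
      have hN' : σ * (((x + u : ℕ) - k : ℝ) * α - (N + U : ℤ)) + d = (D + d) * (y + β) := by
        push_cast
        linarith
      have hy0 : 0 ≤ (D + d) * y := by positivity
      rw [hw, hfr]
      refine ⟨(hR _).2 ⟨N + U, ?_, ?_⟩, ?_, N + U, hN'⟩
      · change -d < σ * (((x + u : ℕ) - k : ℝ) * α - (N + U : ℤ))
        linarith
      · change σ * (((x + u : ℕ) - k : ℝ) * α - (N + U : ℤ)) < D
        linarith
      · change Nat.count R (x + u) = i + 1
        rw [count_add_eq_succ (by omega) hx, hc]
        intro z hz hz' hRz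
        obtain ⟨N', h1, h2⟩ := hbetween z hz hRz
        have := hmin_u ((z : ℤ) - x) N' (by omega) (by linarith) (by linarith)
        omega
    · have hfloor : ⌊(i + 1 : ℝ) * β + β⌋ = F + 1 := by
        rw [Int.floor_eq_iff]
        push_cast
        constructor <;> linarith
      have hw : charWord β i = Letter.b := by
        rw [charWord_eq, hfloor, if_neg (by simp [← hF])]
      have hfr : Int.fract (((i + 1 : ℕ) + 1 : ℝ) * β) = y + β - 1 := by
        push_cast
        rw [show ((i : ℝ) + 1 + 1) * β = (i + 1) * β + β by ring, Int.fract, hfloor]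
        push_cast
        linarith
      have hyD : D + d ≤ (D + d) * y + d := by
        rw [← hDβ]
        nlinarith
      have hyD' : (D + d) * y < D + d := mul_lt_of_lt_one_right (by positivity) hf1
      have hN' : σ * (((x + v : ℕ) - k : ℝ) * α - (N + V : ℤ)) + d = (D + d) * (y + β - 1) := by
        push_cast
        linarith
      rw [hw, hfr]
      refine ⟨(hR _).2 ⟨N + V, ?_, ?_⟩, ?_, N + V, hN'⟩
      · change -d < σ * (((x + v : ℕ) - k : ℝ) * α - (N + V : ℤ))
        -- Landing on the excluded left end would make `(x + v - k + u) α` an integer, with a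
        -- positive coefficient because `k < u`.
        refine lt_of_le_of_ne (by linarith) fun hc => ?_
        rw [← hU, ← mul_neg] at hc
        have hc' := mul_left_cancel₀ hσ0 hc
        refine mul_ne_intCast hα (r := (x : ℤ) + v - k + u) (by omega) (N + V + U) ?_
        push_cast at hc' ⊢
        linarith
      · change σ * (((x + v : ℕ) - k : ℝ) * α - (N + V : ℤ)) < D
        linarith
      · change Nat.count R (x + v) = i + 1
        rw [count_add_eq_succ (by omega) hx, hc]
        intro z hz hz' hRz
        obtain ⟨N', h1, h2⟩ := hbetween z hz hRz
        have := hmin_v ((z : ℤ) - x) N' (by omega) (by linarith) (by linarith)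
        omega
  have main : ∀ i, R (Nat.nth R i) ∧ Nat.count R (Nat.nth R i) = i ∧
      ∃ N : ℤ, σ * (((Nat.nth R i : ℝ) - k) * α - N) + d =
        (D + d) * Int.fract ((i + 1 : ℝ) * β) := by
    -- A visit preceded by exactly `i` visits is `Nat.nth R i`, whether or not `R` is yet known to
    -- be infinite.
    have of_exists : ∀ i x, (R x ∧ Nat.count R x = i ∧ ∃ N : ℤ,
        σ * (((x : ℝ) - k) * α - N) + d = (D + d) * Int.fract ((i + 1 : ℝ) * β)) →
        Nat.nth R i = x := by
      rintro i x ⟨hx, hc, -⟩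
      rw [← hc, Nat.nth_count hx]
    intro i
    induction i with
    | zero => rw [of_exists 0 k base]; exact base
    | succ i ih => rw [of_exists _ _ (step i _ ih)]; exact step i _ ih
  refine ⟨?_, fun i => (main i).1, fun i => ?_⟩
  · rw [← base.2.1, Nat.nth_count base.1]
  · have := step i _ (main i)
    conv_lhs => rw [← this.2.1]
    exact Nat.nth_count this.1

/-! ### From return times to occurrences: the two ranges of `k` -/

lemma eval_pos {u v : ℕ} (hu : 0 < u) (hv : 0 < v) (l : Letter) : 0 < l.eval u v := by
  cases l <;> assumption

lemma occ_of_nth {x y : ℕ → Letter} {w : List Letter} {k u v : ℕ} (hu : 0 < u) (hv : 0 < v)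
    (h : Nat.nth (OccursAt x w) 0 = k ∧ (∀ i, OccursAt x w (Nat.nth (OccursAt x w) i)) ∧
      ∀ i, Nat.nth (OccursAt x w) (i + 1) = Nat.nth (OccursAt x w) i + (y i).eval u v) :
    {p : ℕ | OccursAt x w p}.Infinite ∧ occ x w 1 = k ∧
      ∀ i, 1 ≤ i → occ x w (i + 1) = occ x w i + overAlphabet y u v i := by
  obtain ⟨h0, hmem, hstep⟩ := h
  refine ⟨?_, h0, fun i hi => ?_⟩
  · refine Set.infinite_of_injective_forall_mem (f := Nat.nth (OccursAt x w)) ?_ hmem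
    refine (strictMono_nat_of_lt_succ fun i => ?_).injective
    rw [hstep]
    exact Nat.lt_add_of_pos_right (eval_pos hu hv _)
  · obtain ⟨i, rfl⟩ := Nat.exists_eq_add_of_le' hi
    exact hstep i

/-- The window contains `q α n` but stops short of `q α (n + 1) + q α n`, so `D = err α n`. -/
theorem occ_conj_of_add_two_le {α : ℝ} (hα : Irrational α) (h0 : 0 < α) (h1 : α < 1 / 2)
    (n k : ℕ) (hk : k + 2 ≤ q α n) :
    {p : ℕ | OccursAt (charWord α) (conj k (stdWord α (n + 1))) p}.Infinite ∧
    occ (charWord α) (conj k (stdWord α (n + 1))) 1 = k ∧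
    ∀ i, 1 ≤ i → occ (charWord α) (conj k (stdWord α (n + 1))) (i + 1) =
      occ (charWord α) (conj k (stdWord α (n + 1))) i +
        overAlphabet (charWord (shiftSlope α (n + 1) 1)) (q α (n + 1)) (q α n) i := by
  have h1' : α < 1 := by linarith
  have h := convergentPair hα h0 h1' n
  have hd := h.pos
  have hlt := h.lt
  have hq := q_mono hα h0 h1' n
  have hslope : shiftSlope α (n + 1) 1 = err α (n + 1) / (err α n + err α (n + 1)) := by
    have hg := (gaussIter_spec hα h0 h1' (n + 1)).2.1
    have he := err_pos hα h0 h1' n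
    rw [shiftSlope_one hα h0 h1', err]
    field_simp
    ring
  rw [hslope]
  refine occ_of_nth (by omega) (by omega) (nth_visit hα hd (hd.trans hlt) h.err_eq h.err_eq'
    (by omega) (by omega) (fun r N hr => h.le_of_mem hr) (fun r N hr => h.le_of_mem' hr) ?_)
  intro p
  rw [occursAt_conj_iff hα h0 h1 n k (by omega), charWord_agree_iff h0 h1']
  refine h.agree_iff hα rfl (by omega) (hd.trans hlt) le_rfl ?_ ?_
  · intro m M hm hm' hM
    by_contra! hc
    have := h.add_le_of_mem hm hM hc
    omega
  · refine ⟨q α n - (k + 1), num α n, by omega, ?_⟩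
    rw [← h.err_eq', show ((k : ℤ) + 1 + (q α n - (k + 1) : ℕ)) = q α n by omega]

/-- The window now reaches `q α (n + 1) + q α n`, at signed distance `d - d'`, so `D = d' - d` and
the interval has length `d'`. -/
theorem occ_conj_of_le_add_one {α : ℝ} (hα : Irrational α) (h0 : 0 < α) (h1 : α < 1 / 2)
    (n k : ℕ) (hkq : k < q α (n + 1)) (hk : q α n ≤ k + 1) :
    {p : ℕ | OccursAt (charWord α) (conj k (stdWord α (n + 1))) p}.Infinite ∧
    occ (charWord α) (conj k (stdWord α (n + 1))) 1 = k ∧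
    ∀ i, 1 ≤ i → occ (charWord α) (conj k (stdWord α (n + 1))) (i + 1) =
      occ (charWord α) (conj k (stdWord α (n + 1))) i +
        overAlphabet (charWord (shiftSlope α (n + 1) 0)) (q α (n + 1))
          (q α (n + 1) + q α n) i := by
  have h1' : α < 1 := by linarith
  have h := convergentPair hα h0 h1' n
  have hd := h.pos
  have hlt := h.lt
  have hq' := one_le_q hα h0 h1' n
  have hslope : shiftSlope α (n + 1) 0 =
      err α (n + 1) / (err α n - err α (n + 1) + err α (n + 1)) := by
    have he := err_pos hα h0 h1' n
    rw [shiftSlope_zero hα h0 h1', sub_add_cancel, err]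
    field_simp
  have hV : (((-1) ^ (n + 1) : ℤ) * ((q α (n + 1) + q α n : ℕ) * α -
      ((num α (n + 1) : ℤ) + (num α n : ℤ) : ℤ)) : ℝ) = -(err α n - err α (n + 1)) := by
    have e := h.err_eq
    have e' := h.err_eq'
    push_cast at e e' ⊢
    linarith
  rw [hslope]
  refine occ_of_nth (by omega) (by omega) (nth_visit hα hd (sub_pos.2 hlt) h.err_eq hV
    (by omega) (by omega) (fun r N hr a b => h.le_of_mem hr (by linarith) (by linarith))
    (fun r N hr a b => ?_) ?_)
  · have := h.add_le_of_mem hr (by linarith) b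
    exact_mod_cast this
  intro p
  rw [occursAt_conj_iff hα h0 h1 n k hkq, charWord_agree_iff h0 h1']
  refine h.agree_iff hα rfl hkq (sub_pos.2 hlt) (by linarith) ?_ ?_
  · intro m M hm hm' hM
    by_contra! hc
    have := h.two_mul_add_le_of_mem hm hM hc
    omega
  · refine ⟨q α (n + 1) + q α n - (k + 1), num α (n + 1) + num α n, by omega, ?_⟩
    rw [← hV, show ((k : ℤ) + 1 + (q α (n + 1) + q α n - (k + 1) : ℕ)) =
      (q α (n + 1) + q α n : ℕ) by omega]
    push_cast
    ring

end Sturmian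

theorem mainTheorem4 (α : ℝ) (hα : Irrational α) (hα0 : 0 < α) (hα1 : α < 1 / 2)
    (n : ℕ) (hn : 1 ≤ n) (k : ℕ) (hk : k < Sturmian.q α n)
    (w : List Sturmian.Letter) (hw : w = Sturmian.conj k (Sturmian.stdWord α n)) :
    {p : ℕ | Sturmian.OccursAt (Sturmian.charWord α) w p}.Infinite ∧
    Sturmian.occ (Sturmian.charWord α) w 1 = k ∧
    (k + 2 ≤ Sturmian.q α (n - 1) → ∀ i : ℕ, 1 ≤ i →
      Sturmian.occ (Sturmian.charWord α) w (i + 1) = Sturmian.occ (Sturmian.charWord α) w i +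
        Sturmian.overAlphabet (Sturmian.charWord (Sturmian.shiftSlope α n 1))
          (Sturmian.q α n) (Sturmian.q α (n - 1)) i) ∧
    (Sturmian.q α (n - 1) ≤ k + 1 → ∀ i : ℕ, 1 ≤ i →
      Sturmian.occ (Sturmian.charWord α) w (i + 1) = Sturmian.occ (Sturmian.charWord α) w i +
        Sturmian.overAlphabet (Sturmian.charWord (Sturmian.shiftSlope α n 0))
          (Sturmian.q α n) (Sturmian.q α n + Sturmian.q α (n - 1)) i) := by
  obtain ⟨n, rfl⟩ := Nat.exists_eq_add_of_le' hn
  subst hw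
  rw [Nat.add_sub_cancel]
  rcases Nat.lt_or_ge (k + 1) (Sturmian.q α n) with h | h
  · obtain ⟨hinf, hfirst, hnext⟩ := Sturmian.occ_conj_of_add_two_le hα hα0 hα1 n k h
    exact ⟨hinf, hfirst, fun _ => hnext, fun h' => absurd h' (not_le.2 h)⟩
  · obtain ⟨hinf, hfirst, hnext⟩ := Sturmian.occ_conj_of_le_add_one hα hα0 hα1 n k hk h
    exact ⟨hinf, hfirst, fun h' => absurd h' (by omega), fun _ => hnext⟩
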